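/- A planted plane tree is a finite rooted tree in which each vertex has an arbitrary finite number of children and the children of each vertex are linearly ordered from left to right. Let $\mathcal T_n$ be the (finite) set of planted plane trees with $n$ vertices. An embedding of a planted plane tree $S$ into a planted plane tree $T$ is a set $A$ of vertices of $T$ which, with the ancestor order of $T$, is isomorphic to the poset of vertices of $S$ by an isomorphism that respects the left-to-right order of the children of each vertex of $S$; it is good if $A$ contains the root of $T$. Let $a_T(S)$ and $g_T(S)$ be the numbers of all embeddings and of good embeddings of $S$ into $T$, and put $$a_{\mathcal T_n}(S)=\sum_{T\in\mathcal T_n}a_T(S),\qquad g_{\mathcal T_n}(S)=\sum_{T\in\mathcal T_n}g_T(S).$$ **Theorem.** Let $S$ be a planted plane tree with $m\ge 1$ vertices, let $d_i$ be the number of its vertices with exactly $i$ children, let $l=d_0$ be the number of its leaves, and let $C=\prod_{i=1}^{m-1}\boldsymbol C_{i-1}^{\,d_i}$, where $\boldsymbol C_k=\frac1{k+1}\binom{2k}{k}$. Then, as $n\to\infty$, $$a_{\mathcal T_n}(S)\sim\frac{C\cdot(1/2)^{m+l}}{\Gamma\left(\frac{m+l-1}{2}\right)}\cdot 4^n\cdot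 n^{\frac{m+l-3}{2}}.$$ If $m\ge 2$, then $$g_{\mathcal T_n}(S)\sim\frac{2C\cdot(1/2)^{m+l}}{\Gamma\left(\frac{m+l-2}{2}\right)}\cdot 4^n\cdot n^{\frac{m+l-4}{2}},$$ and if $m=1$ (that is, $S$ is a single vertex), then $$g_{\mathcal T_n}(S)\sim\frac{1}{4\sqrt{\pi}}\cdot 4^n\cdot n^{-3/2}.$$ -/

import Mathlib

open Filter Asymptotics

/-- Planted plane trees (Catalan trees): a root together with the finite, possibly empty, ordered
list of the subtrees attached to it, listed from left to right. -/
inductive PlaneTree : Type where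
  | node : List PlaneTree → PlaneTree

namespace PlaneTree

/-- The size of a tree, that is, its number of vertices. -/
def size : PlaneTree → ℕ
  | node ts => 1 + (ts.map size).sum

/-- `T.degreeCount i` is the number `d_i` of vertices of `T` whose out-degree (number of
children) is equal to `i`. In particular `T.degreeCount 0` is the number of leaves. -/
def degreeCount (i : ℕ) : PlaneTree → ℕ
  | node ts => (if ts.length = i then 1 else 0) + (ts.map (degreeCount i)).sum

/-- The vertices of a tree, named by their addresses: `[]` is the root, and `i :: p` is the vertex
with address `p` inside the `i`-th subtree (counted from `0`, from left to right) attached to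
the root. -/
inductive IsVertex : PlaneTree → List ℕ → Prop where
  | root (T : PlaneTree) : IsVertex T []
  | child {ts : List PlaneTree} {i : ℕ} {t : PlaneTree} {p : List ℕ} :
      ts[i]? = some t → IsVertex t p → IsVertex (node ts) (i :: p)

/-- The set of all (addresses of) vertices of a tree. A vertex `u` is an ancestor of `v`, or equal
to `v`, exactly when the address `u` is a prefix of the address `v`, written `u <+: v`; this is the
tree order, with the root as maximal element. -/
def vertices (T : PlaneTree) : Set (List ℕ) := {p | T.IsVertex p}

/-- `LeftOf u v`: below some common ancestor `p`, the vertex `u` lies in (the subtree rooted at) a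
child of `p` that is strictly to the left of the child of `p` below which `v` lies. -/
def LeftOf (u v : List ℕ) : Prop :=
  ∃ (p : List ℕ) (i j : ℕ), i < j ∧ (p ++ [i]) <+: u ∧ (p ++ [j]) <+: v

/-- `A` is (the vertex set of) an embedding of the plane tree `S` into the plane tree `T`: a
subposet of `T` that is isomorphic to the poset `S`, by an isomorphism for which the left-to-right
order of the children of each node of `S` is inherited from `T`. -/
def IsEmbedding (S T : PlaneTree) (A : Set (List ℕ)) : Prop :=
  A ⊆ T.vertices ∧
    ∃ φ : List ℕ → List ℕ, Set.BijOn φ S.vertices A ∧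
      (∀ u ∈ S.vertices, ∀ v ∈ S.vertices, (u <+: v ↔ φ u <+: φ v)) ∧
      (∀ (u : List ℕ) (i j : ℕ), u ++ [i] ∈ S.vertices → u ++ [j] ∈ S.vertices → i < j →
        LeftOf (φ (u ++ [i])) (φ (u ++ [j])))

/-- The number `a_T(S)` of all embeddings of `S` into `T`. -/
noncomputable def embCount (T S : PlaneTree) : ℕ :=
  {A : Set (List ℕ) | IsEmbedding S T A}.ncard

/-- The number `g_T(S)` of good embeddings of `S` into `T`: those that contain the root of `T`. -/
noncomputable def goodEmbCount (T S : PlaneTree) : ℕ :=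
  {A : Set (List ℕ) | IsEmbedding S T A ∧ [] ∈ A}.ncard

theorem finite_vertices : ∀ T : PlaneTree, T.vertices.Finite
  | node ts => by
    have h : (node ts).vertices ⊆ {[]} ∪ ⋃ t ∈ {t | t ∈ ts}, ⋃ i ∈ Set.Iio ts.length,
        (fun p => i :: p) '' t.vertices := by
      intro p hp
      cases hp with
      | root => simp
      | @child _ i t q h1 h2 =>
        right
        obtain ⟨hi, rfl⟩ := List.getElem?_eq_some_iff.mp h1
        simp only [Set.mem_iUnion]
        exact ⟨ts[i], List.getElem_mem hi, i, hi, q, h2, rfl⟩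
    refine Set.Finite.subset ((Set.finite_singleton _).union ?_) h
    refine Set.Finite.biUnion (List.finite_toSet ts) fun t ht => ?_
    exact Set.Finite.biUnion (Set.finite_Iio _) fun i _ => (finite_vertices t).image _
termination_by T => sizeOf T
decreasing_by
  have := List.sizeOf_lt_of_mem ht
  simp only [node.sizeOf_spec]
  omega

/-- Both counts are counts of elements of finite sets. -/
theorem finite_embeddings (T S : PlaneTree) : {A : Set (List ℕ) | IsEmbedding S T A}.Finite :=
  (finite_vertices T).finite_subsets.subset fun _ h => h.1

theorem finite_size_le (n : ℕ) : {T : PlaneTree | T.size ≤ n}.Finite := by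
  induction n with
  | zero =>
    convert Set.finite_empty
    ext T
    cases T
    simp [size]
  | succ n ih =>
    have : Finite {T : PlaneTree // T.size ≤ n} := ih
    refine ((List.finite_length_le {T : PlaneTree // T.size ≤ n} n).image
      fun l => node (l.map Subtype.val)).subset ?_
    rintro ⟨ts⟩ h
    have h' : (ts.map size).sum ≤ n := by
      have h0 : 1 + (ts.map size).sum ≤ n + 1 := by
        simpa only [Set.mem_ofPred_eq, size] using h
      omega
    have hm : ∀ t ∈ ts, t.size ≤ n := fun t ht =>
      (List.single_le_sum (by simp) _ (List.mem_map_of_mem ht)).trans h'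
    refine ⟨ts.attachWith _ hm, ?_, by simp⟩
    have h1 : ts.length ≤ (ts.map size).sum := by
      have := List.length_le_sum_of_one_le (ts.map size) (by
        intro i hi
        obtain ⟨⟨us⟩, -, rfl⟩ := List.mem_map.mp hi
        simp [size])
      simpa using this
    simpa using h1.trans h'

theorem finite_size_eq (n : ℕ) : {T : PlaneTree | T.size = n}.Finite :=
  (finite_size_le n).subset fun _ h => le_of_eq h

/-- The family `𝒯_n` of all planted plane trees of size `n`. -/
noncomputable def family (n : ℕ) : Finset PlaneTree := (finite_size_eq n).toFinset

/-- `a_{𝒯_n}(S)`: the cumulative number of embeddings of `S` into all trees of size `n`. -/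
noncomputable def totalEmb (S : PlaneTree) (n : ℕ) : ℕ := ∑ T ∈ family n, embCount T S

/-- `g_{𝒯_n}(S)`: the cumulative number of good embeddings of `S` into all trees of size `n`. -/
noncomputable def totalGoodEmb (S : PlaneTree) (n : ℕ) : ℕ := ∑ T ∈ family n, goodEmbCount T S

/-- The constant `C = ∏_{i=1}^{m-1} C_{i-1}^{d_i}`, where `m` is the size of `S` and `C_k` is the
`k`-th Catalan number. -/
def catalanConst (S : PlaneTree) : ℕ :=
  ∏ i ∈ Finset.Icc 1 (S.size - 1), catalan (i - 1) ^ S.degreeCount i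

end PlaneTree

/-!
A set `A` of vertices is an embedding of `S` exactly when, ordered by ancestry and from left to
right, it has the shape of `S`. It pays to count the sets with the shape of a plane forest `L`:
the good embeddings of `node L` into a tree are the embeddings of `L` that avoid the root, and if
the tree is split into its leftmost subtree `t` and the rest, an embedding of `L` is an initial
segment of `L` embedded into `t` together with the remaining trees embedded into the rest.

For the generating functions this is a convolution. Let `B = (1 - √(1 - 4 X)) / 2` be the
generating function of all plane trees. When `L` has at least two trees, the two extreme terms of
the convolution contribute `2 B` times the unknown series. Moving them to the other side leaves
`√(1 - 4 X)` times the unknown series equal to a sum over the ways to cut `L` into two nonempty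
forests. By induction, every series is a power of `1 - 4 X` times a polynomial in `√(1 - 4 X)`.
The leading exponent depends only on `m + l`, and the leading coefficients obey Segner's recurrence
in the number of trees of `L`, which produces the Catalan numbers. The asymptotics of the
coefficients follow from the product formula for `Γ`.
-/

section Singularity

open PowerSeries Topology

/-- The power series of `(1 - r X) ^ a`, for a real exponent `a`. -/
noncomputable def oneSubMulPow (r a : ℝ) : ℝ⟦X⟧ := rescale (-r) (binomialSeries ℝ a)

variable {r : ℝ}

theorem oneSubMulPow_add (r a b : ℝ) :
    oneSubMulPow r (a + b) = oneSubMulPow r a * oneSubMulPow r b := by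
  rw [oneSubMulPow, binomialSeries_add, map_mul, oneSubMulPow, oneSubMulPow]

theorem oneSubMulPow_zero (r : ℝ) : oneSubMulPow r 0 = 1 := by
  rw [oneSubMulPow, binomialSeries_zero, map_one]

theorem oneSubMulPow_one (r : ℝ) : oneSubMulPow r 1 = 1 - C r * X := by
  have h := binomialSeries_nat (R := ℝ) (A := ℝ) 1
  rw [Nat.cast_one, pow_one] at h
  rw [oneSubMulPow, h, map_add, map_one, rescale_X, map_neg, neg_mul, ← sub_eq_add_neg]

theorem oneSubMulPow_natCast_mul (r a : ℝ) (n : ℕ) :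
    oneSubMulPow r (n * a) = oneSubMulPow r a ^ n := by
  induction n with
  | zero => simp [oneSubMulPow_zero]
  | succ n ih => rw [pow_succ, ← ih, ← oneSubMulPow_add, Nat.cast_succ, add_one_mul]

theorem constantCoeff_oneSubMulPow (r a : ℝ) : constantCoeff (oneSubMulPow r a) = 1 := by
  rw [oneSubMulPow, ← coeff_zero_eq_constantCoeff_apply, coeff_rescale, pow_zero, one_mul,
    coeff_zero_eq_constantCoeff_apply, binomialSeries_constantCoeff]

theorem eq_oneSubMulPow_half_of_sq {f : ℝ⟦X⟧} (hf : f ^ 2 = 1 - C r * X)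
    (h0 : constantCoeff f = 1) : f = oneSubMulPow r (1 / 2) := by
  have hsq : f ^ 2 = oneSubMulPow r (1 / 2) ^ 2 := by
    rw [hf, ← oneSubMulPow_natCast_mul, ← oneSubMulPow_one]
    norm_num
  refine (sq_eq_sq_iff_eq_or_eq_neg.1 hsq).resolve_right fun h => ?_
  have := congrArg constantCoeff h
  rw [map_neg, h0, constantCoeff_oneSubMulPow] at this
  norm_num at this

theorem ascPochhammer_smeval_eq_prod (a : ℝ) (n : ℕ) :
    (ascPochhammer ℕ n).smeval a = ∏ i ∈ Finset.range n, (a + i) := by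
  induction n with
  | zero => simp
  | succ n ih =>
    rw [ascPochhammer_succ_right, Polynomial.smeval_mul, ih, Finset.prod_range_succ,
      Polynomial.smeval_add, Polynomial.smeval_X, Polynomial.smeval_natCast, npow_one, npow_zero,
      nsmul_one]

theorem coeff_oneSubMulPow_neg (r a : ℝ) (n : ℕ) :
    coeff n (oneSubMulPow r (-a)) = r ^ n * (∏ i ∈ Finset.range n, (a + i)) / n.factorial := by
  have h := Ring.factorial_nsmul_multichoose_eq_ascPochhammer a n
  rw [ascPochhammer_smeval_eq_prod, nsmul_eq_mul] at h
  have hsign : ((Int.negOnePow n : ℤˣ) : ℝ) = (-1) ^ n := by simp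
  rw [oneSubMulPow, coeff_rescale, binomialSeries_coeff, Ring.choose_neg', ← h, Units.smul_def,
    zsmul_eq_mul, hsign, smul_eq_mul, mul_one, ← mul_assoc, ← mul_pow, neg_mul_neg, mul_one]
  field_simp

theorem tendsto_coeff_oneSubMulPow_neg (hr : r ≠ 0) (a : ℝ) :
    Tendsto (fun n : ℕ => coeff n (oneSubMulPow r (-a)) / (r ^ n * (n : ℝ) ^ (a - 1))) atTop
      (𝓝 (Real.Gamma a)⁻¹) := by
  by_cases ha : Real.Gamma a = 0
  · obtain ⟨m, rfl⟩ := (Real.Gamma_eq_zero_iff a).1 ha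
    rw [ha, inv_zero]
    refine tendsto_const_nhds.congr' ?_
    filter_upwards [eventually_gt_atTop m] with n hn
    rw [coeff_oneSubMulPow_neg, Finset.prod_eq_zero (Finset.mem_range.2 hn) (by simp), mul_zero,
      zero_div, zero_div]
  · have hlim := ((Real.GammaSeq_tendsto_Gamma a).inv₀ ha).mul (tendsto_natCast_div_add_atTop a)
    rw [mul_one] at hlim
    refine hlim.congr' ?_
    filter_upwards [eventually_gt_atTop 0,
      tendsto_natCast_atTop_atTop.eventually_gt_atTop (-a)] with n hn hna
    have hn' : (0 : ℝ) < n := Nat.cast_pos.2 hn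
    have hna' : (n : ℝ) + a ≠ 0 := by linarith
    have hpow : (n : ℝ) ^ a ≠ 0 := (Real.rpow_pos_of_pos hn' a).ne'
    rw [Real.GammaSeq, inv_div, Finset.prod_range_succ, coeff_oneSubMulPow_neg,
      Real.rpow_sub_one hn'.ne']
    field_simp
    ring

theorem tendsto_coeff_oneSubMulPow_neg_of_lt (hr : r ≠ 0) {a b : ℝ} (hab : a < b) :
    Tendsto (fun n : ℕ => coeff n (oneSubMulPow r (-a)) / (r ^ n * (n : ℝ) ^ (b - 1))) atTop
      (𝓝 0) := by
  have hlim := (tendsto_coeff_oneSubMulPow_neg hr a).mul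
    ((tendsto_rpow_neg_atTop (sub_pos.2 hab)).comp tendsto_natCast_atTop_atTop)
  rw [mul_zero] at hlim
  refine hlim.congr' ?_
  filter_upwards [eventually_gt_atTop 0] with n hn
  have hn' : (0 : ℝ) < n := Nat.cast_pos.2 hn
  rw [Function.comp_apply, Real.rpow_neg hn'.le, ← div_eq_mul_inv, div_div, mul_assoc,
    ← Real.rpow_add hn', show a - 1 + (b - a) = b - 1 by ring]

theorem isEquivalent_of_tendsto_div_geom_mul_rpow {u : ℕ → ℝ} {b c : ℝ} (hc : c ≠ 0)
    (h : Tendsto (fun n : ℕ => u n / (r ^ n * (n : ℝ) ^ b)) atTop (𝓝 c)) :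
    u ~[atTop] fun n : ℕ => c * r ^ n * (n : ℝ) ^ b := by
  refine isEquivalent_of_tendsto_one ?_
  have hlim := h.div_const c
  rw [div_self hc] at hlim
  refine hlim.congr fun n => ?_
  rw [Pi.div_apply, div_div]
  ring_nf

/-- `HasSingularity f r α c`: the power series `f` is `(1 - r X) ^ (-α)` times a polynomial in
`√(1 - r X)` with constant term `c`. So `1 / r` is the only possible singularity of `f`, and there
`f` behaves like `c (1 - r X) ^ (-α)`; the number `c` may be `0`. -/
def HasSingularity (f : ℝ⟦X⟧) (r α c : ℝ) : Prop :=
  ∃ p : Polynomial ℝ,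
    f = oneSubMulPow r (-α) * Polynomial.aeval (oneSubMulPow r (1 / 2)) p ∧ p.coeff 0 = c

namespace HasSingularity

variable {f g : ℝ⟦X⟧} {α β c d : ℝ}

theorem mul (hf : HasSingularity f r α c) (hg : HasSingularity g r β d) :
    HasSingularity (f * g) r (α + β) (c * d) := by
  obtain ⟨p, rfl, rfl⟩ := hf
  obtain ⟨q, rfl, rfl⟩ := hg
  refine ⟨p * q, ?_, Polynomial.mul_coeff_zero p q⟩
  rw [map_mul, neg_add, oneSubMulPow_add]
  ring

theorem sum {ι : Type*} {s : Finset ι} {f : ι → ℝ⟦X⟧} {c : ι → ℝ}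
    (h : ∀ i ∈ s, HasSingularity (f i) r α (c i)) :
    HasSingularity (∑ i ∈ s, f i) r α (∑ i ∈ s, c i) := by
  choose! p hp hc using h
  refine ⟨∑ i ∈ s, p i, ?_, ?_⟩
  · rw [map_sum, Finset.mul_sum, Finset.sum_congr rfl hp]
  · rw [Polynomial.finsetSum_coeff, Finset.sum_congr rfl hc]

theorem of_sqrt_mul (h : HasSingularity (oneSubMulPow r (1 / 2) * f) r α c) :
    HasSingularity f r (α + 1 / 2) c := by
  obtain ⟨p, hp, rfl⟩ := h
  refine ⟨p, ?_, rfl⟩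
  rw [neg_add_rev, oneSubMulPow_add, mul_assoc, ← hp, ← mul_assoc, ← oneSubMulPow_add,
    neg_add_cancel, oneSubMulPow_zero, one_mul]

theorem tendsto_coeff (hr : r ≠ 0) (h : HasSingularity f r α c) :
    Tendsto (fun n : ℕ => coeff n f / (r ^ n * (n : ℝ) ^ (α - 1))) atTop
      (𝓝 (c / Real.Gamma α)) := by
  obtain ⟨p, hp, rfl⟩ := h
  have hf : f = (∑ j ∈ Finset.range p.natDegree,
      C (p.coeff (j + 1)) * oneSubMulPow r (-(α - (j + 1) / 2))) +
        C (p.coeff 0) * oneSubMulPow r (-α) := by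
    rw [hp, Polynomial.aeval_eq_sum_range, Finset.sum_range_succ', mul_add, Finset.mul_sum,
      pow_zero, smul_eq_C_mul, mul_one, mul_comm (C _)]
    congr 1
    refine Finset.sum_congr rfl fun j _ => ?_
    rw [smul_eq_C_mul, mul_left_comm, ← oneSubMulPow_natCast_mul, ← oneSubMulPow_add]
    push_cast
    ring_nf
  have hlim := (tendsto_finsetSum (Finset.range p.natDegree) fun j _ =>
    (tendsto_coeff_oneSubMulPow_neg_of_lt hr (sub_lt_self α
      (by positivity : (0 : ℝ) < (j + 1) / 2))).const_mul (p.coeff (j + 1))).add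
    ((tendsto_coeff_oneSubMulPow_neg hr α).const_mul (p.coeff 0))
  simp only [mul_zero, Finset.sum_const_zero, zero_add, ← div_eq_mul_inv] at hlim
  refine hlim.congr fun n => ?_
  simp only [hf, map_add, map_sum, coeff_C_mul, add_div, Finset.sum_div, mul_div_assoc]

theorem isEquivalent (hr : r ≠ 0) (h : HasSingularity f r α c) (hc : c ≠ 0)
    (hα : Real.Gamma α ≠ 0) :
    (fun n => coeff n f) ~[atTop]
      fun n : ℕ => c / Real.Gamma α * r ^ n * (n : ℝ) ^ (α - 1) :=
  isEquivalent_of_tendsto_div_geom_mul_rpow (div_ne_zero hc hα) (h.tendsto_coeff hr)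

end HasSingularity

end Singularity

namespace PlaneTree

section Shape

/-- The strict form of the tree order on addresses: `u` is a proper ancestor of `v`. -/
def IsAncestor (u v : List ℕ) : Prop := u <+: v ∧ u ≠ v

variable {u v w : List ℕ}

theorem isAncestor_nil_left : IsAncestor [] v ↔ v ≠ [] := by
  simp [IsAncestor, eq_comm]

theorem isAncestor_cons_cons {i j : ℕ} :
    IsAncestor (i :: u) (j :: v) ↔ i = j ∧ IsAncestor u v := by
  simp only [IsAncestor, List.cons_prefix_cons, ne_eq, List.cons.injEq]
  tauto

theorem IsAncestor.irrefl (u : List ℕ) : ¬ IsAncestor u u := fun h => h.2 rfl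

theorem IsAncestor.asymm (h : IsAncestor u v) : ¬ IsAncestor v u := fun h' =>
  h.2 (h.1.eq_of_length_le h'.1.length_le)

theorem leftOf_cons_cons {i j : ℕ} :
    LeftOf (i :: u) (j :: v) ↔ i < j ∨ i = j ∧ LeftOf u v := by
  constructor
  · rintro ⟨_ | ⟨c, w⟩, a, b, hab, hu, hv⟩
    · simp only [List.nil_append, List.cons_prefix_cons] at hu hv
      exact Or.inl (hu.1 ▸ hv.1 ▸ hab)
    · simp only [List.cons_append, List.cons_prefix_cons] at hu hv
      exact Or.inr ⟨hu.1.symm.trans hv.1, w, a, b, hab, hu.2, hv.2⟩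
  · rintro (h | ⟨rfl, w, a, b, hab, hu, hv⟩)
    · exact ⟨[], i, j, h, by simp, by simp⟩
    · exact ⟨i :: w, a, b, hab, by simpa using hu, by simpa using hv⟩

theorem not_leftOf_nil_left (v : List ℕ) : ¬ LeftOf [] v := by
  rintro ⟨w, i, j, -, h, -⟩
  simp at h

theorem LeftOf.mono {u' v' : List ℕ} (h : LeftOf u v) (hu : u <+: u') (hv : v <+: v') :
    LeftOf u' v' := by
  obtain ⟨p, i, j, hij, hi, hj⟩ := h
  exact ⟨p, i, j, hij, hi.trans hu, hj.trans hv⟩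

theorem LeftOf.asymm (h : LeftOf u v) : ¬ LeftOf v u := by
  induction u generalizing v with
  | nil => exact absurd h (not_leftOf_nil_left v)
  | cons i u ih =>
    cases v with
    | nil => exact not_leftOf_nil_left _
    | cons j v =>
      rw [leftOf_cons_cons] at h ⊢
      rintro (h' | ⟨rfl, h'⟩)
      · omega
      · exact ih (h.resolve_left (lt_irrefl j)).2 h'

theorem LeftOf.irrefl (u : List ℕ) : ¬ LeftOf u u := fun h => h.asymm h

theorem LeftOf.not_prefix_left (h : LeftOf u v) : ¬ u <+: v := fun h' =>
  LeftOf.irrefl v (h.mono h' (List.prefix_refl v))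

theorem LeftOf.not_prefix_right (h : LeftOf u v) : ¬ v <+: u := fun h' =>
  LeftOf.irrefl u (h.mono (List.prefix_refl u) h')

theorem eq_or_isAncestor_or_leftOf (u v : List ℕ) :
    u = v ∨ IsAncestor u v ∨ IsAncestor v u ∨ LeftOf u v ∨ LeftOf v u := by
  induction u generalizing v with
  | nil => cases v <;> simp [isAncestor_nil_left]
  | cons i u ih =>
    cases v with
    | nil => simp [isAncestor_nil_left]
    | cons j v =>
      simp only [List.cons.injEq, isAncestor_cons_cons, leftOf_cons_cons]
      rcases lt_trichotomy i j with h | rfl | h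
      · simp [h]
      · simpa using ih v
      · simp [h]

/-- The map `f` preserves, on the set `A` of addresses, the ancestor relation and the left-to-right
order. -/
structure IsPlaneMapOn (f : List ℕ → List ℕ) (A : Set (List ℕ)) : Prop where
  isAncestor : ∀ ⦃u⦄, u ∈ A → ∀ ⦃v⦄, v ∈ A → IsAncestor u v → IsAncestor (f u) (f v)
  leftOf : ∀ ⦃u⦄, u ∈ A → ∀ ⦃v⦄, v ∈ A → LeftOf u v → LeftOf (f u) (f v)

variable {f g : List ℕ → List ℕ} {A B : Set (List ℕ)} {r : List ℕ}

namespace IsPlaneMapOn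

theorem mono (h : IsPlaneMapOn f A) (hBA : B ⊆ A) : IsPlaneMapOn f B :=
  ⟨fun _ hu _ hv => h.isAncestor (hBA hu) (hBA hv), fun _ hu _ hv => h.leftOf (hBA hu) (hBA hv)⟩

theorem isAncestor_iff (h : IsPlaneMapOn f A) (hu : u ∈ A) (hv : v ∈ A) :
    IsAncestor (f u) (f v) ↔ IsAncestor u v := by
  refine ⟨fun hf => ?_, h.isAncestor hu hv⟩
  rcases eq_or_isAncestor_or_leftOf u v with rfl | huv | hvu | huv | hvu
  · exact absurd hf (IsAncestor.irrefl _)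
  · exact huv
  · exact absurd (h.isAncestor hv hu hvu) hf.asymm
  · exact absurd hf.1 (h.leftOf hu hv huv).not_prefix_left
  · exact absurd hf.1 (h.leftOf hv hu hvu).not_prefix_right

theorem leftOf_iff (h : IsPlaneMapOn f A) (hu : u ∈ A) (hv : v ∈ A) :
    LeftOf (f u) (f v) ↔ LeftOf u v := by
  refine ⟨fun hf => ?_, h.leftOf hu hv⟩
  rcases eq_or_isAncestor_or_leftOf u v with rfl | huv | hvu | huv | hvu
  · exact absurd hf (LeftOf.irrefl _)
  · exact absurd (h.isAncestor hu hv huv).1 hf.not_prefix_left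
  · exact absurd (h.isAncestor hv hu hvu).1 hf.not_prefix_right
  · exact huv
  · exact absurd (h.leftOf hv hu hvu) hf.asymm

theorem injOn (h : IsPlaneMapOn f A) : Set.InjOn f A := by
  intro u hu v hv huv
  have hanc := h.isAncestor hu hv
  have hanc' := h.isAncestor hv hu
  have hleft := h.leftOf hu hv
  have hleft' := h.leftOf hv hu
  rw [huv] at hanc hanc' hleft hleft'
  have := IsAncestor.irrefl (f v)
  have := LeftOf.irrefl (f v)
  have := eq_or_isAncestor_or_leftOf u v
  tauto

theorem prefix_iff (h : IsPlaneMapOn f A) (hu : u ∈ A) (hv : v ∈ A) :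
    f u <+: f v ↔ u <+: v := by
  rcases eq_or_ne u v with rfl | hne
  · simp
  · simpa [IsAncestor, hne, h.injOn.ne hu hv hne] using h.isAncestor_iff hu hv

theorem of_leftInvOn (h : IsPlaneMapOn f A) (hg : Set.LeftInvOn g f A) :
    IsPlaneMapOn g (f '' A) := by
  constructor
  · rintro _ ⟨u, hu, rfl⟩ _ ⟨v, hv, rfl⟩ huv
    rwa [hg hu, hg hv, ← h.isAncestor_iff hu hv]
  · rintro _ ⟨u, hu, rfl⟩ _ ⟨v, hv, rfl⟩ huv
    rwa [hg hu, hg hv, ← h.leftOf_iff hu hv]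

theorem congr (h : IsPlaneMapOn f A) (hfg : Set.EqOn f g A) : IsPlaneMapOn g A := by
  constructor <;> intro u hu v hv huv <;> rw [← hfg hu, ← hfg hv]
  · exact h.isAncestor hu hv huv
  · exact h.leftOf hu hv huv

theorem insert (h : IsPlaneMapOn f A) (hr : ∀ a ∈ A, IsAncestor r a)
    (hfr : ∀ a ∈ A, IsAncestor (f r) (f a)) : IsPlaneMapOn f (insert r A) := by
  constructor
  · rintro u (rfl | hu) v (rfl | hv) huv
    · exact absurd huv (IsAncestor.irrefl _)
    · exact hfr v hv
    · exact absurd huv (hr u hu).asymm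
    · exact h.isAncestor hu hv huv
  · rintro u (rfl | hu) v (rfl | hv) huv
    · exact absurd huv (LeftOf.irrefl _)
    · exact absurd (hr v hv).1 huv.not_prefix_left
    · exact absurd (hr u hu).1 huv.not_prefix_right
    · exact h.leftOf hu hv huv

theorem union (hA : IsPlaneMapOn f A) (hB : IsPlaneMapOn f B)
    (h : ∀ a ∈ A, ∀ b ∈ B, LeftOf a b) (hf : ∀ a ∈ A, ∀ b ∈ B, LeftOf (f a) (f b)) :
    IsPlaneMapOn f (A ∪ B) := by
  constructor
  · rintro u (hu | hu) v (hv | hv) huv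
    · exact hA.isAncestor hu hv huv
    · exact absurd huv.1 (h u hu v hv).not_prefix_left
    · exact absurd huv.1 (h v hv u hu).not_prefix_right
    · exact hB.isAncestor hu hv huv
  · rintro u (hu | hu) v (hv | hv) huv
    · exact hA.leftOf hu hv huv
    · exact hf u hu v hv
    · exact absurd huv (h v hv u hu).asymm
    · exact hB.leftOf hu hv huv

end IsPlaneMapOn

theorem disjoint_of_forall_leftOf (h : ∀ a ∈ A, ∀ b ∈ B, LeftOf a b) : Disjoint A B :=
  Set.disjoint_left.2 fun a ha hb => LeftOf.irrefl a (h a ha a hb)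

/-- `HasShape L A`: ordered by the ancestor relation and from left to right, the set `A` of
addresses is a plane forest whose trees are, in this order, the members of `L`. In `cons`, the
address `r` is the root of the first tree, and `A₀` consists of the other vertices of that tree. -/
inductive HasShape : List PlaneTree → Set (List ℕ) → Prop where
  | nil : HasShape [] ∅
  | cons {L₀ L : List PlaneTree} {A₀ A : Set (List ℕ)} {r : List ℕ} :
      HasShape L₀ A₀ → HasShape L A → (∀ a ∈ A₀, IsAncestor r a) → (∀ a ∈ A, LeftOf r a) →
      HasShape (node L₀ :: L) (insert r A₀ ∪ A)

variable {L L₀ L₁ L₂ : List PlaneTree} {A₀ : Set (List ℕ)}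

theorem leftOf_of_mem_insert (hA₀ : ∀ a ∈ A₀, IsAncestor r a) (hA : ∀ a ∈ A, LeftOf r a) :
    ∀ a ∈ insert r A₀, ∀ b ∈ A, LeftOf a b := by
  rintro a (rfl | ha) b hb
  · exact hA b hb
  · exact (hA b hb).mono (hA₀ a ha).1 (List.prefix_refl b)

theorem hasShape_nil_iff : HasShape [] A ↔ A = ∅ := by
  refine ⟨fun h => ?_, fun h => h ▸ .nil⟩
  cases h
  rfl

theorem hasShape_empty_iff : HasShape L ∅ ↔ L = [] := by
  refine ⟨fun h => ?_, fun h => h ▸ .nil⟩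
  generalize hA : (∅ : Set (List ℕ)) = A at h
  cases h with
  | nil => rfl
  | @cons _ _ A₀ A r => exact absurd (hA ▸ Or.inl (Set.mem_insert r A₀)) (Set.notMem_empty r)

theorem HasShape.image (h : HasShape L A) (hf : IsPlaneMapOn f A) : HasShape L (f '' A) := by
  induction h with
  | nil => simpa using HasShape.nil
  | @cons L₀ L A₀ A r _ _ hanc hleft ih₀ ih =>
    have hr : r ∈ insert r A₀ ∪ A := Or.inl (Set.mem_insert r A₀)
    have hA₀ : A₀ ⊆ insert r A₀ ∪ A := fun a ha => Or.inl (Or.inr ha)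
    have hA : A ⊆ insert r A₀ ∪ A := Set.subset_union_right
    rw [Set.image_union, Set.image_insert_eq]
    exact .cons (ih₀ (hf.mono hA₀)) (ih (hf.mono hA))
      (Set.forall_mem_image.2 fun a ha => hf.isAncestor hr (hA₀ ha) (hanc a ha))
      (Set.forall_mem_image.2 fun a ha => hf.leftOf hr (hA ha) (hleft a ha))

theorem hasShape_image_iff (hf : IsPlaneMapOn f A) : HasShape L (f '' A) ↔ HasShape L A := by
  refine ⟨fun h => ?_, fun h => h.image hf⟩
  have hinv : Set.LeftInvOn (Function.invFunOn f A) f A := hf.injOn.leftInvOn_invFunOn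
  have := h.image (hf.of_leftInvOn hinv)
  rwa [hinv.image_image] at this

theorem HasShape.exists_isPlaneMapOn (hA : HasShape L A) (hB : HasShape L B) :
    ∃ f, IsPlaneMapOn f A ∧ f '' A = B := by
  classical
  induction hA generalizing B with
  | nil => exact ⟨id, ⟨by simp, by simp⟩, by rw [hasShape_nil_iff.1 hB, Set.image_empty]⟩
  | @cons L₀ L A₀ A r _ _ hanc hleft ih₀ ih =>
    cases hB with | @cons _ _ B₀ B r' hB₀ hB hanc' hleft' =>
    obtain ⟨f₀, hf₀, hf₀B₀⟩ := ih₀ hB₀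
    obtain ⟨f, hf, hfB⟩ := ih hB
    have hlt := leftOf_of_mem_insert hanc hleft
    have hlt' := leftOf_of_mem_insert hanc' hleft'
    let φ : List ℕ → List ℕ := (insert r A₀).piecewise (Function.update f₀ r r') f
    have hφr : φ r = r' := by simp [φ]
    have hφ₀ : Set.EqOn f₀ φ A₀ := fun a ha => by simp [φ, ha, (hanc a ha).2.symm]
    have hφ : Set.EqOn f φ A := fun a ha => (Set.piecewise_eq_of_notMem _ _ _
      (Set.disjoint_right.1 (disjoint_of_forall_leftOf hlt) ha)).symm
    have hφB₀ : φ '' A₀ = B₀ := hφ₀.image_eq.symm.trans hf₀B₀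
    have hφB : φ '' A = B := hφ.image_eq.symm.trans hfB
    have hφinsert : φ '' insert r A₀ = insert r' B₀ := by rw [Set.image_insert_eq, hφr, hφB₀]
    refine ⟨φ, .union (.insert (hf₀.congr hφ₀) hanc fun a ha => ?_) (hf.congr hφ) hlt
      fun a ha b hb => ?_, by rw [Set.image_union, hφinsert, hφB]⟩
    · exact hφr ▸ hanc' _ (hφB₀ ▸ Set.mem_image_of_mem φ ha)
    · exact hlt' _ (hφinsert ▸ Set.mem_image_of_mem φ ha) _ (hφB ▸ Set.mem_image_of_mem φ hb)

theorem HasShape.encard (h : HasShape L A) : A.encard = (L.map size).sum := by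
  induction h with
  | nil => simp
  | @cons L₀ L A₀ A r _ _ hanc hleft ih₀ ih =>
    have hr : r ∉ A₀ := fun hr => IsAncestor.irrefl r (hanc r hr)
    have hdisj := disjoint_of_forall_leftOf (leftOf_of_mem_insert hanc hleft)
    rw [Set.encard_union_eq hdisj, Set.encard_insert_of_notMem hr, ih₀, ih, List.map_cons,
      List.sum_cons, size]
    push_cast
    ring

theorem HasShape.union (h₁ : HasShape L₁ A) (h₂ : HasShape L₂ B)
    (h : ∀ a ∈ A, ∀ b ∈ B, LeftOf a b) : HasShape (L₁ ++ L₂) (A ∪ B) := by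
  induction h₁ with
  | nil => simpa using h₂
  | @cons L₀ L A₀ A r h₀ _ hanc hleft _ ih =>
    rw [Set.union_assoc]
    refine .cons h₀ (ih fun a ha => h a (Or.inr ha)) hanc ?_
    rintro a (ha | ha)
    · exact hleft a ha
    · exact h r (Or.inl (Set.mem_insert r A₀)) a ha

theorem HasShape.exists_of_union {D : Set (List ℕ)} (hD : HasShape L D) (hAB : D = A ∪ B)
    (h : ∀ a ∈ A, ∀ b ∈ B, LeftOf a b) :
    ∃ L₁ L₂, L = L₁ ++ L₂ ∧ HasShape L₁ A ∧ HasShape L₂ B := by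
  induction hD generalizing A with
  | nil =>
    obtain ⟨rfl, rfl⟩ := Set.union_empty_iff.1 hAB.symm
    exact ⟨[], [], rfl, .nil, .nil⟩
  | @cons L₀ L A₀ A' r h₀ h' hanc hleft _ ih =>
    have hr : r ∈ A ∪ B := hAB ▸ Or.inl (Set.mem_insert r A₀)
    rcases hr with hr | hr
    · have hA₀ : insert r A₀ ⊆ A := by
        refine Set.insert_subset hr fun a ha => ?_
        have : a ∈ A ∪ B := hAB ▸ Or.inl (Or.inr ha)
        exact this.resolve_right fun hb => (h r hr a hb).not_prefix_left (hanc a ha).1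
      have hB : B ⊆ A' := fun b hb => by
        have : b ∈ insert r A₀ ∪ A' := hAB ▸ Or.inr hb
        exact this.resolve_left fun ha => LeftOf.irrefl b (h b (hA₀ ha) b hb)
      have hA' : A' = A ∩ A' ∪ B := by
        rw [Set.union_comm, Set.union_inter_distrib_left, Set.union_comm B A, ← hAB,
          Set.union_eq_self_of_subset_left hB, Set.inter_eq_self_of_subset_right (by simp)]
      have hA : insert r A₀ ∪ A ∩ A' = A := by
        rw [Set.union_inter_distrib_left, hAB, Set.union_eq_self_of_subset_left hA₀,
          Set.inter_eq_self_of_subset_left Set.subset_union_left]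
      obtain ⟨L₁, L₂, rfl, h₁, h₂⟩ := ih hA' fun a ha => h a ha.1
      exact ⟨node L₀ :: L₁, L₂, rfl, hA ▸ .cons h₀ h₁ hanc fun a ha => hleft a ha.2, h₂⟩
    · obtain rfl : A = ∅ := by
        refine Set.eq_empty_of_forall_notMem fun a ha => ?_
        have har := h a ha r hr
        have : a ∈ insert r A₀ ∪ A' := hAB ▸ Or.inl ha
        rcases this with (rfl | ha) | ha
        · exact LeftOf.irrefl a har
        · exact har.not_prefix_right (hanc a ha).1
        · exact har.asymm (hleft a ha)
      rw [Set.empty_union] at hAB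
      exact ⟨[], node L₀ :: L, rfl, .nil, hAB ▸ .cons h₀ h' hanc hleft⟩

theorem hasShape_union_iff (h : ∀ a ∈ A, ∀ b ∈ B, LeftOf a b) :
    HasShape L (A ∪ B) ↔ ∃ L₁ L₂, L = L₁ ++ L₂ ∧ HasShape L₁ A ∧ HasShape L₂ B := by
  refine ⟨fun hL => hL.exists_of_union rfl h, ?_⟩
  rintro ⟨L₁, L₂, rfl, h₁, h₂⟩
  exact h₁.union h₂ h

theorem hasShape_insert_iff (hr : ∀ a ∈ A, IsAncestor r a) :
    HasShape L (insert r A) ↔ ∃ L₀, L = [node L₀] ∧ HasShape L₀ A := by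
  constructor
  · generalize hD : insert r A = D
    have hrD : r ∈ D := hD ▸ Set.mem_insert r A
    intro h
    cases h with
    | nil => exact absurd hrD (Set.notMem_empty r)
    | @cons L₀ L A₀ A' r' h₀ h' hanc hleft =>
      obtain rfl : r' = r := by
        have hr' : r' ∈ insert r A := hD ▸ Or.inl (Set.mem_insert r' A₀)
        refine hr'.resolve_right fun hr' => ?_
        rcases hrD with (rfl | hrA₀) | hrA'
        · exact IsAncestor.irrefl _ (hr _ hr')
        · exact (hr _ hr').asymm (hanc _ hrA₀)
        · exact (hleft _ hrA').not_prefix_right (hr _ hr').1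
      obtain rfl : A' = ∅ := by
        refine Set.eq_empty_of_forall_notMem fun a ha => ?_
        have : a ∈ insert r' A := hD ▸ Or.inr ha
        rcases this with rfl | haA
        · exact LeftOf.irrefl a (hleft a ha)
        · exact (hleft a ha).not_prefix_left (hr a haA).1
      obtain rfl := hasShape_empty_iff.1 h'
      have hrA : r' ∉ A := fun hrA => IsAncestor.irrefl r' (hr r' hrA)
      have hrA₀ : r' ∉ A₀ := fun hrA₀ => IsAncestor.irrefl r' (hanc r' hrA₀)
      rw [Set.union_empty] at hD
      obtain rfl : A = A₀ := by
        rw [← Set.insert_sdiff_self_of_notMem hrA, hD, Set.insert_sdiff_self_of_notMem hrA₀]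
      exact ⟨L₀, rfl, h₀⟩
  · rintro ⟨L₀, rfl, h⟩
    simpa using HasShape.cons h .nil hr (by simp)

end Shape
section Count

theorem size_pos : ∀ T : PlaneTree, 0 < T.size
  | node L => by rw [size]; omega

theorem eq_of_prefix_of_sum_size_eq {L L' : List PlaneTree} (h : L <+: L')
    (hsum : (L.map size).sum = (L'.map size).sum) : L = L' := by
  obtain ⟨_ | ⟨T, M⟩, rfl⟩ := h
  · exact (List.append_nil L).symm
  · have := T.size_pos
    simp only [List.map_append, List.sum_append, List.map_cons, List.sum_cons] at hsum
    omega

variable {L L₀ : List PlaneTree} {V W A : Set (List ℕ)} {r : List ℕ}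

theorem HasShape.take_inj {j k : ℕ} (hj : j ≤ L.length) (hk : k ≤ L.length)
    (hAj : HasShape (L.take j) A) (hAk : HasShape (L.take k) A) : j = k := by
  have hsum : ((L.take j).map size).sum = ((L.take k).map size).sum := by
    exact_mod_cast hAj.encard.symm.trans hAk.encard
  have htake : L.take j = L.take k :=
    (List.prefix_or_prefix_of_prefix (List.take_prefix j L) (List.take_prefix k L)).elim
      (eq_of_prefix_of_sum_size_eq · hsum) fun h => (eq_of_prefix_of_sum_size_eq h hsum.symm).symm
  have := congrArg List.length htake
  rwa [List.length_take_of_le hj, List.length_take_of_le hk] at this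

/-- The embeddings of the plane forest with trees `L` into the set `V` of addresses. -/
def shapes (L : List PlaneTree) (V : Set (List ℕ)) : Set (Set (List ℕ)) :=
  {A | A ⊆ V ∧ HasShape L A}

/-- The number of embeddings of the plane forest with trees `L` into the set `V` of addresses; only
used for finite `V`, since `Set.ncard` is `0` on infinite sets. -/
noncomputable def shapeCount (L : List PlaneTree) (V : Set (List ℕ)) : ℕ := (shapes L V).ncard

theorem finite_shapes (L : List PlaneTree) (hV : V.Finite) : (shapes L V).Finite :=
  hV.finite_subsets.subset fun _ h => h.1

theorem shapeCount_empty (L : List PlaneTree) : shapeCount L ∅ = if L = [] then 1 else 0 := by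
  have hshapes : shapes L ∅ = {A | A = ∅ ∧ L = []} := by
    ext A
    simp only [shapes, Set.subset_empty_iff, Set.mem_ofPred_eq]
    exact and_congr_right fun h => h ▸ hasShape_empty_iff
  rw [shapeCount, hshapes]
  split_ifs with h <;> simp [h]

theorem shapeCount_image {f : List ℕ → List ℕ} (hf : IsPlaneMapOn f V) :
    shapeCount L (f '' V) = shapeCount L V := by
  have hshapes : shapes L (f '' V) = Set.image f '' shapes L V := by
    ext B
    simp only [shapes, Set.mem_ofPred_eq, Set.mem_image, Set.subset_image_iff]
    constructor
    · rintro ⟨⟨A, hA, rfl⟩, hB⟩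
      exact ⟨A, ⟨hA, (hasShape_image_iff (hf.mono hA)).1 hB⟩, rfl⟩
    · rintro ⟨A, ⟨hA, hB⟩, rfl⟩
      exact ⟨⟨A, hA, rfl⟩, hB.image (hf.mono hA)⟩
  rw [shapeCount, hshapes, Set.InjOn.ncard_image (hf.injOn.image.mono fun A hA => hA.1), shapeCount]

theorem ncard_rooted_shapes (hr : ∀ a ∈ V, IsAncestor r a) :
    {A ∈ shapes [node L] (insert r V) | r ∈ A}.ncard = shapeCount L V := by
  have hrV : r ∉ V := fun h => IsAncestor.irrefl r (hr r h)
  have hshapes : {A ∈ shapes [node L] (insert r V) | r ∈ A} = insert r '' shapes L V := by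
    ext A
    constructor
    · rintro ⟨⟨hAV, hA⟩, hrA⟩
      have hAr : insert r (A \ {r}) = A := by
        rw [Set.insert_sdiff_singleton, Set.insert_eq_of_mem hrA]
      have hsub : A \ {r} ⊆ V := by simpa using hAV
      rw [← hAr, hasShape_insert_iff fun a ha => hr a (hsub ha)] at hA
      obtain ⟨L', hL', hA⟩ := hA
      obtain rfl : L = L' := by simpa using hL'
      exact ⟨A \ {r}, ⟨hsub, hA⟩, hAr⟩
    · rintro ⟨B, ⟨hBV, hB⟩, rfl⟩
      exact ⟨⟨Set.insert_subset_insert hBV,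
        (hasShape_insert_iff fun a ha => hr a (hBV ha)).2 ⟨L, rfl, hB⟩⟩, Set.mem_insert r B⟩
  rw [hshapes, shapeCount, Set.InjOn.ncard_image]
  intro A hA B hB h
  rw [← Set.insert_sdiff_self_of_notMem fun h => hrV (hA.1 h), h,
    Set.insert_sdiff_self_of_notMem fun h => hrV (hB.1 h)]

theorem shapes_insert (L : List PlaneTree) (hr : r ∉ V) :
    shapes L (insert r V) = shapes L V ∪ {A ∈ shapes L (insert r V) | r ∈ A} := by
  ext A
  by_cases hrA : r ∈ A
  · simp [shapes, hrA, show ¬ A ⊆ V from fun h => hr (h hrA)]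
  · simp [shapes, hrA, Set.subset_insert_iff_of_notMem]

theorem shapeCount_singleton_insert (hV : V.Finite) (hr : ∀ a ∈ V, IsAncestor r a) :
    shapeCount [node L] (insert r V) = shapeCount [node L] V + shapeCount L V := by
  have hrV : r ∉ V := fun h => IsAncestor.irrefl r (hr r h)
  have hdisj : Disjoint (shapes [node L] V) {A ∈ shapes [node L] (insert r V) | r ∈ A} :=
    Set.disjoint_left.2 fun A hA hA' => hrV (hA.1 hA'.2)
  rw [shapeCount, shapes_insert _ hrV, Set.ncard_union_eq hdisj (finite_shapes _ hV)
    ((finite_shapes _ (hV.insert r)).subset (Set.sep_subset _ _)), ncard_rooted_shapes hr]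
  rfl

theorem shapeCount_insert_of_length_ne_one (hL : L.length ≠ 1) (hr : ∀ a ∈ V, IsAncestor r a) :
    shapeCount L (insert r V) = shapeCount L V := by
  have hrooted : {A ∈ shapes L (insert r V) | r ∈ A} = ∅ := by
    refine Set.eq_empty_of_forall_notMem ?_
    rintro A ⟨⟨hAV, hA⟩, hrA⟩
    rw [← Set.insert_eq_of_mem hrA, ← Set.insert_sdiff_singleton, hasShape_insert_iff] at hA
    · obtain ⟨L', rfl, -⟩ := hA
      exact hL rfl
    · exact fun a ha => hr a ((hAV ha.1).resolve_left ha.2)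
  rw [shapeCount, shapes_insert L fun h => IsAncestor.irrefl r (hr r h), hrooted, Set.union_empty,
    shapeCount]

theorem shapes_union (L : List PlaneTree) (h : ∀ a ∈ V, ∀ b ∈ W, LeftOf a b) :
    shapes L (V ∪ W) = ⋃ k ∈ (Finset.range (L.length + 1) : Set ℕ),
      (fun P => P.1 ∪ P.2) '' (shapes (L.take k) V ×ˢ shapes (L.drop k) W) := by
  ext D
  simp only [Set.mem_iUnion, Finset.coe_range, Set.mem_Iio, exists_prop, Set.mem_image,
    Prod.exists, Set.mem_prod]
  constructor
  · rintro ⟨hD, hshape⟩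
    have hDVW : D ∩ V ∪ D ∩ W = D := by
      rw [← Set.inter_union_distrib_left, Set.inter_eq_self_of_subset_left hD]
    rw [← hDVW, hasShape_union_iff fun a ha b hb => h a ha.2 b hb.2] at hshape
    obtain ⟨L₁, L₂, rfl, h₁, h₂⟩ := hshape
    exact ⟨L₁.length, by simp, D ∩ V, D ∩ W, ⟨⟨Set.inter_subset_right, by simpa⟩,
      Set.inter_subset_right, by simpa⟩, hDVW⟩
  · rintro ⟨k, -, A, B, ⟨⟨hAV, hA⟩, hBW, hB⟩, rfl⟩
    refine ⟨Set.union_subset_union hAV hBW, ?_⟩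
    rw [← List.take_append_drop k L]
    exact hA.union hB fun a ha b hb => h a (hAV ha) b (hBW hb)

theorem shapeCount_union (L : List PlaneTree) (hV : V.Finite) (hW : W.Finite)
    (h : ∀ a ∈ V, ∀ b ∈ W, LeftOf a b) :
    shapeCount L (V ∪ W) = ∑ k ∈ Finset.range (L.length + 1),
      shapeCount (L.take k) V * shapeCount (L.drop k) W := by
  have hdisj := disjoint_of_forall_leftOf h
  have hV_part : ∀ {A B}, A ⊆ V → B ⊆ W → (A ∪ B) ∩ V = A := fun hA hB => by
    rw [Set.union_inter_distrib_right, Set.inter_eq_self_of_subset_left hA,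
      (hdisj.symm.mono_left hB).inter_eq, Set.union_empty]
  have hW_part : ∀ {A B}, A ⊆ V → B ⊆ W → (A ∪ B) ∩ W = B := fun hA hB => by
    rw [Set.union_inter_distrib_right, Set.inter_eq_self_of_subset_left hB,
      (hdisj.mono_left hA).inter_eq, Set.empty_union]
  rw [shapeCount, shapes_union L h, Set.Finite.ncard_biUnion (Finset.finite_toSet _),
    finsum_mem_coe_finset]
  · refine Finset.sum_congr rfl fun k _ => ?_
    rw [Set.InjOn.ncard_image, Set.ncard_prod, shapeCount, shapeCount]
    rintro ⟨A, B⟩ hAB ⟨A', B'⟩ hAB' (heq : A ∪ B = A' ∪ B')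
    obtain ⟨⟨hA : A ⊆ V, -⟩, hB : B ⊆ W, -⟩ := hAB
    obtain ⟨⟨hA' : A' ⊆ V, -⟩, hB' : B' ⊆ W, -⟩ := hAB'
    exact Prod.ext ((hV_part hA hB).symm.trans (heq ▸ hV_part hA' hB'))
      ((hW_part hA hB).symm.trans (heq ▸ hW_part hA' hB'))
  · exact fun k _ => ((finite_shapes _ hV).prod (finite_shapes _ hW)).image _
  · intro j hj k hk hjk
    refine Set.disjoint_left.2 ?_
    rintro _ ⟨⟨A, B⟩, ⟨hA, hB⟩, rfl⟩ ⟨⟨A', B'⟩, ⟨hA', hB'⟩, (heq : A' ∪ B' = A ∪ B)⟩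
    have hfst : A' = A := (hV_part hA'.1 hB'.1).symm.trans (heq ▸ hV_part hA.1 hB.1)
    simp only [Finset.coe_range, Set.mem_Iio, Nat.lt_succ_iff] at hj hk
    exact hjk (hA.2.take_inj hj hk (hfst ▸ hA'.2))

end Count

section Vertices

/-- The vertices of a tree other than its root, that is, the vertices of the forest that remains
when the root is removed. -/
def descendants (T : PlaneTree) : Set (List ℕ) := T.vertices \ {[]}

/-- The map on addresses that moves every vertex other than the root into the next subtree of the
root to the right; it is only used away from the root `[]`. -/
def shift : List ℕ → List ℕ
  | [] => []
  | i :: p => (i + 1) :: p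

variable {L : List PlaneTree} {T : PlaneTree} {u v : List ℕ} {A : Set (List ℕ)}

theorem nil_notMem_descendants : [] ∉ T.descendants := fun h => h.2 rfl

theorem finite_descendants (T : PlaneTree) : T.descendants.Finite := T.finite_vertices.sdiff

theorem vertices_eq_insert (T : PlaneTree) : T.vertices = insert [] T.descendants := by
  have hroot : [] ∈ T.vertices := .root T
  rw [descendants, Set.insert_sdiff_singleton, Set.insert_eq_of_mem hroot]

theorem isAncestor_nil_of_mem_descendants (hu : u ∈ T.descendants) : IsAncestor [] u :=
  isAncestor_nil_left.2 hu.2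

theorem cons_mem_descendants {i : ℕ} {p : List ℕ} :
    i :: p ∈ (node L).descendants ↔ ∃ t, L[i]? = some t ∧ p ∈ t.vertices := by
  constructor
  · rintro ⟨h | ⟨ht, hp⟩, -⟩
    exact ⟨_, ht, hp⟩
  · rintro ⟨t, ht, hp⟩
    exact ⟨.child ht hp, List.cons_ne_nil i p⟩

theorem descendants_node_nil : (node []).descendants = ∅ := by
  refine Set.eq_empty_of_forall_notMem ?_
  rintro (_ | ⟨i, p⟩) h
  · exact nil_notMem_descendants h
  · simp [cons_mem_descendants] at h

theorem descendants_node_cons (t : PlaneTree) (L : List PlaneTree) :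
    (node (t :: L)).descendants = List.cons 0 '' t.vertices ∪ shift '' (node L).descendants := by
  ext p
  constructor
  · rcases p with _ | ⟨_ | i, p⟩ <;> intro h
    · exact absurd h nil_notMem_descendants
    · exact Or.inl ⟨p, by simpa [cons_mem_descendants] using h, rfl⟩
    · exact Or.inr ⟨i :: p, by simpa [cons_mem_descendants] using h, rfl⟩
  · rintro (⟨p, hp, rfl⟩ | ⟨_ | ⟨i, p⟩, hp, rfl⟩)
    · exact cons_mem_descendants.2 ⟨t, rfl, hp⟩
    · exact absurd hp nil_notMem_descendants
    · exact cons_mem_descendants.2 (by simpa using cons_mem_descendants.1 hp)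

theorem isPlaneMapOn_cons (i : ℕ) (A : Set (List ℕ)) : IsPlaneMapOn (List.cons i) A :=
  ⟨fun _ _ _ _ h => isAncestor_cons_cons.2 ⟨rfl, h⟩,
    fun _ _ _ _ h => leftOf_cons_cons.2 (Or.inr ⟨rfl, h⟩)⟩

theorem isPlaneMapOn_shift (hA : [] ∉ A) : IsPlaneMapOn shift A := by
  constructor <;> intro u hu v hv h
  all_goals
    obtain ⟨i, u, rfl⟩ := List.exists_cons_of_ne_nil (ne_of_mem_of_not_mem hu hA)
    obtain ⟨j, v, rfl⟩ := List.exists_cons_of_ne_nil (ne_of_mem_of_not_mem hv hA)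
  · rw [isAncestor_cons_cons] at h
    exact isAncestor_cons_cons.2 ⟨congrArg (· + 1) h.1, h.2⟩
  · rw [leftOf_cons_cons] at h
    exact leftOf_cons_cons.2 (h.imp Nat.succ_lt_succ (And.imp_left (congrArg (· + 1))))

theorem leftOf_of_mem_cons_image_of_mem_shift_image {B : Set (List ℕ)} (hB : [] ∉ B) :
    ∀ a ∈ List.cons 0 '' A, ∀ b ∈ shift '' B, LeftOf a b := by
  rintro _ ⟨u, -, rfl⟩ _ ⟨_ | ⟨i, v⟩, hv, rfl⟩
  · exact absurd hv hB
  · exact leftOf_cons_cons.2 (Or.inl i.succ_pos)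

theorem hasShape_singleton_insert (h : HasShape L A) (hA : ∀ a ∈ A, IsAncestor u a) :
    HasShape [node L] (insert u A) :=
  (hasShape_insert_iff hA).2 ⟨L, rfl, h⟩

theorem hasShape_descendants : ∀ L : List PlaneTree, HasShape L (node L).descendants
  | [] => descendants_node_nil ▸ .nil
  | node L₀ :: L => by
    have htree : HasShape [node L₀] (node L₀).vertices := by
      rw [vertices_eq_insert]
      exact hasShape_singleton_insert (hasShape_descendants L₀) fun a =>
        isAncestor_nil_of_mem_descendants
    rw [descendants_node_cons]
    exact (htree.image (isPlaneMapOn_cons 0 _)).union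
      ((hasShape_descendants L).image (isPlaneMapOn_shift nil_notMem_descendants))
      (leftOf_of_mem_cons_image_of_mem_shift_image nil_notMem_descendants)

theorem hasShape_vertices : ∀ T : PlaneTree, HasShape [T] T.vertices
  | node L => by
    rw [vertices_eq_insert]
    exact hasShape_singleton_insert (hasShape_descendants L) fun a =>
      isAncestor_nil_of_mem_descendants

theorem IsVertex.of_prefix (h : T.IsVertex v) (huv : u <+: v) : T.IsVertex u := by
  induction h generalizing u with
  | root T => rw [List.prefix_nil.1 huv]; exact .root T
  | child hi _ ih =>
    cases u with
    | nil => exact .root _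
    | cons j u =>
      obtain ⟨rfl, h⟩ := List.cons_prefix_cons.1 huv
      exact .child hi (ih h)

theorem isEmbedding_iff {S : PlaneTree} :
    IsEmbedding S T A ↔ A ∈ shapes [S] T.vertices := by
  refine and_congr_right fun _ => ⟨?_, fun h => ?_⟩
  · rintro ⟨φ, hφ, hprefix, hchildren⟩
    have hmap : IsPlaneMapOn φ S.vertices := by
      refine ⟨fun u hu v hv h => ⟨(hprefix u hu v hv).1 h.1, hφ.injOn.ne hu hv h.2⟩, ?_⟩
      rintro u hu v hv ⟨p, i, j, hij, hi, hj⟩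
      have hi' := IsVertex.of_prefix hu hi
      have hj' := IsVertex.of_prefix hv hj
      exact (hchildren p i j hi' hj' hij).mono ((hprefix _ hi' u hu).1 hi)
        ((hprefix _ hj' v hv).1 hj)
    rw [← hφ.image_eq]
    exact (hasShape_vertices S).image hmap
  · obtain ⟨f, hf, rfl⟩ := (hasShape_vertices S).exists_isPlaneMapOn h
    exact ⟨f, hf.injOn.bijOn_image, fun u hu v hv => (hf.prefix_iff hu hv).symm,
      fun u i j hi hj hij => hf.leftOf hi hj ⟨u, i, j, hij, List.prefix_refl _, List.prefix_refl _⟩⟩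

theorem embCount_eq_shapeCount (T S : PlaneTree) : embCount T S = shapeCount [S] T.vertices := by
  simp only [embCount, isEmbedding_iff]
  rfl

theorem goodEmbCount_node_eq_shapeCount (T : PlaneTree) (L : List PlaneTree) :
    goodEmbCount T (node L) = shapeCount L T.descendants := by
  simp only [goodEmbCount, isEmbedding_iff, vertices_eq_insert T]
  exact ncard_rooted_shapes fun _ => isAncestor_nil_of_mem_descendants

theorem shapeCount_descendants_node_nil (L : List PlaneTree) :
    shapeCount L (node []).descendants = if L = [] then 1 else 0 := by
  rw [descendants_node_nil, shapeCount_empty]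

theorem shapeCount_descendants_node_cons (L : List PlaneTree) (t : PlaneTree)
    (ts : List PlaneTree) :
    shapeCount L (node (t :: ts)).descendants = ∑ k ∈ Finset.range (L.length + 1),
      shapeCount (L.take k) t.vertices * shapeCount (L.drop k) (node ts).descendants := by
  rw [descendants_node_cons, shapeCount_union L (t.finite_vertices.image _)
    ((finite_descendants _).image _)
    (leftOf_of_mem_cons_image_of_mem_shift_image nil_notMem_descendants)]
  simp only [shapeCount_image (isPlaneMapOn_cons 0 _),
    shapeCount_image (isPlaneMapOn_shift nil_notMem_descendants)]

theorem shapeCount_vertices_singleton (L : List PlaneTree) (T : PlaneTree) :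
    shapeCount [node L] T.vertices =
      shapeCount [node L] T.descendants + shapeCount L T.descendants := by
  rw [vertices_eq_insert]
  exact shapeCount_singleton_insert (finite_descendants T) fun _ =>
    isAncestor_nil_of_mem_descendants

theorem shapeCount_vertices_of_length_ne_one (hL : L.length ≠ 1) (T : PlaneTree) :
    shapeCount L T.vertices = shapeCount L T.descendants := by
  rw [vertices_eq_insert]
  exact shapeCount_insert_of_length_ne_one hL fun _ => isAncestor_nil_of_mem_descendants

end Vertices

section GeneratingFunctions

open PowerSeries

/-- The tree obtained from `T` by attaching `t` to its root as the new leftmost subtree. -/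
def graft (t : PlaneTree) : PlaneTree → PlaneTree
  | node ts => node (t :: ts)

theorem size_graft (t : PlaneTree) : ∀ T : PlaneTree, (graft t T).size = t.size + T.size
  | node ts => by rw [graft, size, size, List.map_cons, List.sum_cons]; ring

theorem graft_inj {t t' : PlaneTree} :
    ∀ {T T' : PlaneTree}, graft t T = graft t' T' ↔ t = t' ∧ T = T'
  | node ts, node ts' => by simp [graft]

theorem eq_node_nil_or_exists_eq_graft : ∀ T : PlaneTree, T = node [] ∨ ∃ t T', T = graft t T'
  | node [] => Or.inl rfl
  | node (t :: ts) => Or.inr ⟨t, node ts, rfl⟩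

theorem graft_ne_node_nil (t : PlaneTree) : ∀ T : PlaneTree, graft t T ≠ node []
  | node ts => by simp [graft]

theorem mem_family {T : PlaneTree} {n : ℕ} : T ∈ family n ↔ T.size = n :=
  Set.Finite.mem_toFinset _

theorem sum_family {M : Type*} [AddCommMonoid M] (f : PlaneTree → M) (n : ℕ) :
    ∑ T ∈ family n, f T = (if n = 1 then f (node []) else 0) +
      ∑ p ∈ Finset.HasAntidiagonal.antidiagonal n,
        ∑ t ∈ family p.1, ∑ T ∈ family p.2, f (graft t T) := by
  classical
  rw [← Finset.sum_filter_add_sum_filter_not (family n) (· = node [])]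
  congr 1
  · rw [Finset.sum_filter, Finset.sum_ite_eq']
    simp only [mem_family, size, List.map_nil, List.sum_nil, add_zero, eq_comm]
  · simp_rw [← Finset.sum_product']
    rw [← Finset.sum_sigma (Finset.HasAntidiagonal.antidiagonal n)
      (fun p => family p.1 ×ˢ family p.2) (fun x => f (graft x.2.1 x.2.2))]
    symm
    refine Finset.sum_bij (fun x _ => graft x.2.1 x.2.2) ?_ ?_ ?_ fun _ _ => rfl
    · rintro ⟨⟨a, b⟩, t, T⟩ h
      simp only [Finset.mem_sigma, Finset.HasAntidiagonal.mem_antidiagonal, Finset.mem_product,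
        mem_family] at h
      simp only [Finset.mem_filter, mem_family, size_graft, graft_ne_node_nil, not_false_eq_true,
        and_true, h]
    · rintro ⟨⟨a, b⟩, t, T⟩ h ⟨⟨a', b'⟩, t', T'⟩ h' heq
      simp only [Finset.mem_sigma, Finset.mem_product, mem_family] at h h'
      obtain ⟨rfl, rfl⟩ := graft_inj.1 heq
      obtain ⟨-, rfl, rfl⟩ := h
      obtain ⟨-, rfl, rfl⟩ := h'
      rfl
    · intro T hT
      rw [Finset.mem_filter, mem_family] at hT
      obtain ⟨t, T', rfl⟩ := (eq_node_nil_or_exists_eq_graft T).resolve_left hT.2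
      refine ⟨⟨(t.size, T'.size), t, T'⟩, ?_, rfl⟩
      simp only [Finset.mem_sigma, Finset.HasAntidiagonal.mem_antidiagonal, Finset.mem_product,
        mem_family, ← size_graft, hT.1, and_self]

/-- The generating function `∑ f(T) X ^ |T|` of all plane trees `T`, weighted by `f`. -/
noncomputable def treeGenFun {R : Type*} [Semiring R] (f : PlaneTree → R) : R⟦X⟧ :=
  mk fun n => ∑ T ∈ family n, f T

theorem coeff_zero_treeGenFun {R : Type*} [Semiring R] (f : PlaneTree → R) :
    coeff 0 (treeGenFun f) = 0 := by
  rw [treeGenFun, coeff_mk]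
  exact Finset.sum_eq_zero fun T hT => absurd (mem_family.1 hT) T.size_pos.ne'

theorem treeGenFun_add {R : Type*} [Semiring R] (f g : PlaneTree → R) :
    treeGenFun (fun T => f T + g T) = treeGenFun f + treeGenFun g := by
  ext n
  simp only [treeGenFun, coeff_mk, map_add, Finset.sum_add_distrib]

theorem treeGenFun_eq_of_graft {R ι : Type*} [CommSemiring R] {f : PlaneTree → R} {s : Finset ι}
    {u v : ι → PlaneTree → R} (h : ∀ t T, f (graft t T) = ∑ i ∈ s, u i t * v i T) :
    treeGenFun f = C (f (node [])) * X + ∑ i ∈ s, treeGenFun (u i) * treeGenFun (v i) := by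
  ext n
  rw [treeGenFun, coeff_mk, sum_family, map_add, coeff_C_mul, coeff_X, mul_ite, mul_one, mul_zero,
    map_sum]
  congr 1
  simp only [coeff_mul, treeGenFun, coeff_mk, h, Finset.sum_mul_sum]
  rw [Finset.sum_comm]
  refine Finset.sum_congr rfl fun p _ => ?_
  simp only [Finset.sum_comm (s := s)]

/-- The generating function of the embeddings of the plane forest with trees `L` into plane
trees. -/
noncomputable def embGenFun (L : List PlaneTree) : ℝ⟦X⟧ :=
  treeGenFun fun T => shapeCount L T.vertices

/-- The generating function of the embeddings of the plane forest with trees `L` into plane trees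
that avoid the root; equivalently, of the good embeddings of `node L`. -/
noncomputable def nonrootEmbGenFun (L : List PlaneTree) : ℝ⟦X⟧ :=
  treeGenFun fun T => shapeCount L T.descendants

variable {L : List PlaneTree}

theorem coeff_embGenFun_singleton (S : PlaneTree) (n : ℕ) :
    coeff n (embGenFun [S]) = (S.totalEmb n : ℝ) := by
  simp only [embGenFun, treeGenFun, coeff_mk, totalEmb, embCount_eq_shapeCount, Nat.cast_sum]

theorem coeff_nonrootEmbGenFun (L : List PlaneTree) (n : ℕ) :
    coeff n (nonrootEmbGenFun L) = ((node L).totalGoodEmb n : ℝ) := by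
  simp only [nonrootEmbGenFun, treeGenFun, coeff_mk, totalGoodEmb,
    goodEmbCount_node_eq_shapeCount, Nat.cast_sum]

theorem nonrootEmbGenFun_eq (L : List PlaneTree) :
    nonrootEmbGenFun L = (if L = [] then X else 0) +
      ∑ k ∈ Finset.range (L.length + 1), embGenFun (L.take k) * nonrootEmbGenFun (L.drop k) := by
  have hgraft : ∀ t T, (shapeCount L (graft t T).descendants : ℝ) =
      ∑ k ∈ Finset.range (L.length + 1),
        (shapeCount (L.take k) t.vertices : ℝ) * shapeCount (L.drop k) T.descendants := by
    rintro t ⟨ts⟩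
    rw [graft, shapeCount_descendants_node_cons]
    push_cast
    rfl
  rw [nonrootEmbGenFun, treeGenFun_eq_of_graft hgraft, shapeCount_descendants_node_nil]
  congr 1
  split_ifs <;> simp

theorem embGenFun_of_length_ne_one (hL : L.length ≠ 1) : embGenFun L = nonrootEmbGenFun L := by
  simp only [embGenFun, nonrootEmbGenFun, shapeCount_vertices_of_length_ne_one hL]

theorem embGenFun_singleton (L : List PlaneTree) :
    embGenFun [node L] = nonrootEmbGenFun [node L] + nonrootEmbGenFun L := by
  simp only [embGenFun, nonrootEmbGenFun, shapeCount_vertices_singleton, Nat.cast_add,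
    treeGenFun_add]

theorem nonrootEmbGenFun_nil_eq :
    nonrootEmbGenFun [] = X + nonrootEmbGenFun [] * nonrootEmbGenFun [] := by
  have h := nonrootEmbGenFun_eq []
  rwa [if_pos rfl, List.length_nil, Finset.sum_range_one, List.take_nil, List.drop_nil,
    embGenFun_of_length_ne_one (by simp)] at h

theorem one_sub_two_mul_nonrootEmbGenFun_nil :
    1 - 2 * nonrootEmbGenFun [] = oneSubMulPow 4 (1 / 2) := by
  refine eq_oneSubMulPow_half_of_sq ?_ ?_
  · rw [map_ofNat]
    linear_combination -4 * nonrootEmbGenFun_nil_eq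
  · rw [map_sub, map_one, map_mul, ← coeff_zero_eq_constantCoeff_apply (nonrootEmbGenFun []),
      nonrootEmbGenFun, coeff_zero_treeGenFun, mul_zero, sub_zero]

theorem nonrootEmbGenFun_of_ne_nil (hL : L ≠ []) : nonrootEmbGenFun L =
    nonrootEmbGenFun [] * nonrootEmbGenFun L + embGenFun L * nonrootEmbGenFun [] +
      ∑ k ∈ Finset.range (L.length - 1),
        embGenFun (L.take (k + 1)) * nonrootEmbGenFun (L.drop (k + 1)) := by
  obtain ⟨n, hn : L.length = n + 1⟩ :=
    Nat.exists_eq_succ_of_ne_zero (List.length_eq_zero_iff.not.2 hL)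
  have h := nonrootEmbGenFun_eq L
  rw [if_neg hL, zero_add, hn, Finset.sum_range_succ, Finset.sum_range_succ', List.take_zero,
    List.drop_zero, embGenFun_of_length_ne_one (by simp), ← hn, List.take_length,
    List.drop_length] at h
  rw [hn, Nat.add_sub_cancel]
  linear_combination h

theorem sqrt_mul_nonrootEmbGenFun_singleton (L : List PlaneTree) :
    oneSubMulPow 4 (1 / 2) * nonrootEmbGenFun [node L] =
      nonrootEmbGenFun [] * nonrootEmbGenFun L := by
  have h := nonrootEmbGenFun_of_ne_nil (L := [node L]) (by simp)
  rw [embGenFun_singleton, List.length_singleton, Nat.sub_self, Finset.sum_range_zero] at h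
  rw [← one_sub_two_mul_nonrootEmbGenFun_nil]
  linear_combination h

theorem sqrt_mul_embGenFun_singleton (L : List PlaneTree) :
    oneSubMulPow 4 (1 / 2) * embGenFun [node L] =
      (1 - nonrootEmbGenFun []) * nonrootEmbGenFun L := by
  rw [embGenFun_singleton, mul_add, sqrt_mul_nonrootEmbGenFun_singleton,
    ← one_sub_two_mul_nonrootEmbGenFun_nil]
  ring

theorem sqrt_mul_nonrootEmbGenFun_of_two_le_length (hL : 2 ≤ L.length) :
    oneSubMulPow 4 (1 / 2) * nonrootEmbGenFun L = ∑ k ∈ Finset.range (L.length - 1),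
      embGenFun (L.take (k + 1)) * nonrootEmbGenFun (L.drop (k + 1)) := by
  have h := nonrootEmbGenFun_of_ne_nil (L := L) (List.length_pos_iff.1 (by omega))
  rw [embGenFun_of_length_ne_one (L := L) (by omega)] at h
  rw [← one_sub_two_mul_nonrootEmbGenFun_nil]
  linear_combination h

end GeneratingFunctions

section Constants

theorem length_le_sum_map_size (L : List PlaneTree) : L.length ≤ (L.map size).sum := by
  simpa using List.card_nsmul_le_sum (L.map size) 1 (by simpa using fun t _ => t.size_pos)

theorem degreeCount_eq_zero_of_size_le :
    ∀ (T : PlaneTree) {i : ℕ}, T.size ≤ i → T.degreeCount i = 0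
  | node L, i, h => by
    rw [size] at h
    have hlength := length_le_sum_map_size L
    rw [degreeCount, if_neg (by omega), zero_add, List.sum_eq_zero_iff, List.forall_mem_map]
    intro t ht
    have hsize : t.size ≤ (L.map size).sum :=
      List.single_le_sum (fun _ _ => Nat.zero_le _) _ (List.mem_map_of_mem ht)
    exact degreeCount_eq_zero_of_size_le t (by omega)

theorem degreeCount_zero_pos : ∀ T : PlaneTree, 0 < T.degreeCount 0
  | node [] => by simp [degreeCount]
  | node (t :: L) => by
    rw [degreeCount, List.map_cons, List.sum_cons]
    have := degreeCount_zero_pos t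
    omega

variable {S : PlaneTree} {L : List PlaneTree}

-- The factors `i = 0` are `1`, because `0 - 1 = 0` in `ℕ`.
theorem catalanConst_eq_prod_range {N : ℕ} (hN : S.size ≤ N) :
    S.catalanConst = ∏ i ∈ Finset.range N, catalan (i - 1) ^ S.degreeCount i := by
  refine Finset.prod_subset (fun i hi => ?_) fun i _ hi => ?_
  · rw [Finset.mem_Icc] at hi
    rw [Finset.mem_range]
    omega
  · rcases Nat.eq_zero_or_pos i with rfl | hpos
    · rw [Nat.zero_sub, catalan_zero, one_pow]
    · rw [Finset.mem_Icc] at hi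
      rw [degreeCount_eq_zero_of_size_le S (by omega), pow_zero]

theorem prod_map_catalanConst {N : ℕ} (hN : ∀ t ∈ L, t.size ≤ N) : (L.map catalanConst).prod =
    ∏ i ∈ Finset.range N, catalan (i - 1) ^ (L.map (degreeCount i)).sum := by
  induction L with
  | nil => simp
  | cons t L ih =>
    rw [List.forall_mem_cons] at hN
    simp only [List.map_cons, List.prod_cons, List.sum_cons, pow_add, Finset.prod_mul_distrib,
      ih hN.2, catalanConst_eq_prod_range hN.1]

theorem catalanConst_node (L : List PlaneTree) :
    (node L).catalanConst = catalan (L.length - 1) * (L.map catalanConst).prod := by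
  have hlength : L.length < (node L).size := by
    rw [size]
    have := length_le_sum_map_size L
    omega
  have hsize : ∀ t ∈ L, t.size ≤ (node L).size := fun t ht => by
    rw [size]
    exact (List.single_le_sum (fun _ _ => Nat.zero_le _) _ (List.mem_map_of_mem ht)).trans
      (Nat.le_add_left _ 1)
  rw [catalanConst_eq_prod_range le_rfl, prod_map_catalanConst hsize]
  simp only [degreeCount, pow_add, Finset.prod_mul_distrib, pow_ite, pow_one, pow_zero]
  rw [Finset.prod_ite_eq, if_pos (Finset.mem_range.2 hlength)]

theorem catalanConst_pos (S : PlaneTree) : 0 < S.catalanConst := by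
  refine Finset.prod_pos fun i _ => pow_pos (Nat.pos_of_ne_zero fun h => ?_) _
  have hcentral := succ_mul_catalan_eq_centralBinom (i - 1)
  rw [h, mul_zero] at hcentral
  exact Nat.centralBinom_ne_zero _ hcentral.symm

/-- The number of vertices of a tree plus the number of its leaves: the quantity `m + l` that
governs the growth of the number of embeddings. -/
def order (S : PlaneTree) : ℕ := S.size + S.degreeCount 0

/-- The constant `C (1/2) ^ (m + l)` in the asymptotics of the number of embeddings. -/
noncomputable def weight (S : PlaneTree) : ℝ := S.catalanConst * (1 / 2) ^ S.order

theorem weight_pos (S : PlaneTree) : 0 < S.weight := by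
  have := S.catalanConst_pos
  rw [weight]
  positivity

theorem order_node_nil : (node []).order = 2 := by simp [order, size, degreeCount]

theorem weight_node_nil : (node []).weight = 1 / 4 := by
  rw [weight, order_node_nil, catalanConst_node]
  norm_num

theorem order_node (hL : L ≠ []) : (node L).order = 1 + (L.map order).sum := by
  have hsum : (L.map order).sum = (L.map size).sum + (L.map (degreeCount 0)).sum :=
    List.sum_map_add
  rw [order, size, degreeCount, if_neg (List.length_eq_zero_iff.not.2 hL), hsum]
  ring

theorem prod_map_weight (L : List PlaneTree) :
    (L.map weight).prod = (L.map catalanConst).prod * (1 / 2) ^ (L.map order).sum := by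
  induction L with
  | nil => simp
  | cons t L ih =>
    simp only [List.map_cons, List.prod_cons, List.sum_cons, ih, weight, pow_add, Nat.cast_mul]
    ring

theorem two_mul_weight_node (hL : L ≠ []) :
    2 * (node L).weight = catalan (L.length - 1) * (L.map weight).prod := by
  rw [weight, order_node hL, catalanConst_node, prod_map_weight, pow_add]
  push_cast
  ring

theorem order_node_append {L₁ L₂ : List PlaneTree} (h₁ : L₁ ≠ []) (h₂ : L₂ ≠ []) :
    (node (L₁ ++ L₂)).order + 1 = (node L₁).order + (node L₂).order := by
  rw [order_node h₁, order_node h₂, order_node (List.append_ne_nil_of_left_ne_nil h₁ L₂),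
    List.map_append, List.sum_append]
  ring

-- This is Segner's recurrence for the Catalan numbers.
theorem two_mul_weight_node_eq_sum (hL : 2 ≤ L.length) :
    2 * (node L).weight = ∑ k ∈ Finset.range (L.length - 1),
      2 * (node (L.take (k + 1))).weight * (2 * (node (L.drop (k + 1))).weight) := by
  obtain ⟨n, hn⟩ := Nat.exists_eq_add_of_le' hL
  have hterm : ∀ k ∈ Finset.range (n + 1),
      2 * (node (L.take (k + 1))).weight * (2 * (node (L.drop (k + 1))).weight) =
        (catalan k * catalan (n - k) : ℕ) * (L.map weight).prod := by
    intro k hk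
    rw [Finset.mem_range] at hk
    have htake : (L.take (k + 1)).length = k + 1 := List.length_take_of_le (by omega)
    have hdrop : (L.drop (k + 1)).length = n - k + 1 := by rw [List.length_drop]; omega
    rw [two_mul_weight_node (List.ne_nil_of_length_eq_add_one htake),
      two_mul_weight_node (List.ne_nil_of_length_eq_add_one hdrop), htake, hdrop,
      ← List.prod_take_mul_prod_drop (L.map weight) (k + 1), List.map_take, List.map_drop]
    push_cast
    ring
  have hne : L ≠ [] := List.ne_nil_of_length_eq_add_one hn
  rw [two_mul_weight_node hne, hn, show n + 2 - 1 = n + 1 by omega, Finset.sum_congr rfl hterm,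
    ← Finset.sum_mul, ← Nat.cast_sum, catalan_succ',
    Finset.Nat.sum_antidiagonal_eq_sum_range_succ fun i j => catalan i * catalan j]

end Constants

section Asymptotics

open PowerSeries

theorem nonrootEmbGenFun_nil :
    nonrootEmbGenFun [] = C (1 / 2) - C (1 / 2) * oneSubMulPow 4 (1 / 2) := by
  have htwo : C (1 / 2 : ℝ) * 2 = 1 := by
    rw [← map_ofNat C 2, ← map_mul]
    norm_num
  rw [← one_sub_two_mul_nonrootEmbGenFun_nil]
  linear_combination -nonrootEmbGenFun [] * htwo

theorem hasSingularity_nonrootEmbGenFun_nil :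
    HasSingularity (nonrootEmbGenFun []) 4 0 (1 / 2) := by
  refine ⟨Polynomial.C (1 / 2) - Polynomial.C (1 / 2) * Polynomial.X, ?_, by simp⟩
  simp [nonrootEmbGenFun_nil, oneSubMulPow_zero]

theorem hasSingularity_one_sub_nonrootEmbGenFun_nil :
    HasSingularity (1 - nonrootEmbGenFun []) 4 0 (1 / 2) := by
  refine ⟨1 - (Polynomial.C (1 / 2) - Polynomial.C (1 / 2) * Polynomial.X), ?_, by norm_num⟩
  simp [nonrootEmbGenFun_nil, oneSubMulPow_zero]

variable {L : List PlaneTree}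

theorem hasSingularity_singleton_of_sqrt_mul_eq {f g : ℝ⟦X⟧} (hg : HasSingularity g 4 0 (1 / 2))
    (hf : oneSubMulPow 4 (1 / 2) * f = g * nonrootEmbGenFun L)
    (h : HasSingularity (nonrootEmbGenFun L) 4 (((node L).order - 2) / 2) (2 * (node L).weight)) :
    HasSingularity f 4 (((node [node L]).order - 2) / 2) (2 * (node [node L]).weight) := by
  have hsqrt := hg.mul h
  rw [← hf] at hsqrt
  convert hsqrt.of_sqrt_mul using 1
  · rw [order_node (List.cons_ne_nil _ _)]
    push_cast [List.map_singleton, List.sum_singleton]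
    ring
  · rw [two_mul_weight_node (List.cons_ne_nil _ _)]
    simp

theorem hasSingularity_embGenFun_of_nonrootEmbGenFun (hL : L ≠ [])
    (h : ∀ L', (node L').size ≤ (node L).size →
      HasSingularity (nonrootEmbGenFun L') 4 (((node L').order - 2) / 2) (2 * (node L').weight)) :
    HasSingularity (embGenFun L) 4 (((node L).order - 2) / 2) (2 * (node L).weight) := by
  by_cases hlength : L.length = 1
  · obtain ⟨⟨L'⟩, rfl⟩ := List.length_eq_one_iff.1 hlength
    exact hasSingularity_singleton_of_sqrt_mul_eq hasSingularity_one_sub_nonrootEmbGenFun_nil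
      (sqrt_mul_embGenFun_singleton L') (h L' (by simp [size]))
  · rw [embGenFun_of_length_ne_one hlength]
    exact h L le_rfl

theorem hasSingularity_embGenFun_mul_nonrootEmbGenFun {L₁ L₂ : List PlaneTree} (h₁ : L₁ ≠ [])
    (h₂ : L₂ ≠ [])
    (h : ∀ L, (node L).size < (node (L₁ ++ L₂)).size →
      HasSingularity (nonrootEmbGenFun L) 4 (((node L).order - 2) / 2) (2 * (node L).weight)) :
    HasSingularity (embGenFun L₁ * nonrootEmbGenFun L₂) 4 (((node (L₁ ++ L₂)).order - 3) / 2)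
      (2 * (node L₁).weight * (2 * (node L₂).weight)) := by
  have hlength₁ := (List.length_pos_iff.2 h₁).trans_le (length_le_sum_map_size L₁)
  have hlength₂ := (List.length_pos_iff.2 h₂).trans_le (length_le_sum_map_size L₂)
  have hsize : (node (L₁ ++ L₂)).size = 1 + ((L₁.map size).sum + (L₂.map size).sum) := by
    rw [size, List.map_append, List.sum_append]
  have hleft : (node L₁).size < (node (L₁ ++ L₂)).size := by rw [hsize, size]; omega
  have hright : (node L₂).size < (node (L₁ ++ L₂)).size := by rw [hsize, size]; omega
  have horder : ((node (L₁ ++ L₂)).order : ℝ) + 1 = (node L₁).order + (node L₂).order :=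
    mod_cast order_node_append h₁ h₂
  convert (hasSingularity_embGenFun_of_nonrootEmbGenFun h₁
    fun L hL => h L (hL.trans_lt hleft)).mul (h L₂ hright) using 1
  linarith

theorem hasSingularity_nonrootEmbGenFun (L : List PlaneTree) :
    HasSingularity (nonrootEmbGenFun L) 4 (((node L).order - 2) / 2) (2 * (node L).weight) := by
  induction hN : (node L).size using Nat.strong_induction_on generalizing L with
  | _ N ih =>
    subst hN
    rcases L with _ | ⟨⟨L'⟩, _ | ⟨t, L⟩⟩
    · convert hasSingularity_nonrootEmbGenFun_nil using 1
      · rw [order_node_nil]; norm_num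
      · rw [weight_node_nil]; norm_num
    · exact hasSingularity_singleton_of_sqrt_mul_eq hasSingularity_nonrootEmbGenFun_nil
        (sqrt_mul_nonrootEmbGenFun_singleton L') (ih _ (by simp [size]) L' rfl)
    · generalize hM : node L' :: t :: L = M at ih ⊢
      have hlength : 2 ≤ M.length := by simp [← hM]
      have hterm : ∀ k ∈ Finset.range (M.length - 1),
          HasSingularity (embGenFun (M.take (k + 1)) * nonrootEmbGenFun (M.drop (k + 1))) 4
            (((node M).order - 3) / 2)
            (2 * (node (M.take (k + 1))).weight * (2 * (node (M.drop (k + 1))).weight)) := by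
        intro k hk
        rw [Finset.mem_range] at hk
        have htake : M.take (k + 1) ≠ [] := List.length_pos_iff.1 (by rw [List.length_take]; omega)
        have hdrop : M.drop (k + 1) ≠ [] := List.length_pos_iff.1 (by rw [List.length_drop]; omega)
        rw [← List.take_append_drop (k + 1) M] at ih
        simpa only [List.take_append_drop] using
          hasSingularity_embGenFun_mul_nonrootEmbGenFun htake hdrop fun L h => ih _ h L rfl
      convert (sqrt_mul_nonrootEmbGenFun_of_two_le_length hlength ▸
        HasSingularity.sum hterm).of_sqrt_mul using 1
      · ring
      · exact two_mul_weight_node_eq_sum hlength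

theorem hasSingularity_embGenFun_singleton (S : PlaneTree) :
    HasSingularity (embGenFun [S]) 4 ((S.order - 1) / 2) S.weight := by
  convert hasSingularity_embGenFun_of_nonrootEmbGenFun (List.cons_ne_nil S [])
    fun L _ => hasSingularity_nonrootEmbGenFun L using 1
  · rw [order_node (List.cons_ne_nil _ _)]
    push_cast [List.map_singleton, List.sum_singleton]
    ring
  · rw [two_mul_weight_node (List.cons_ne_nil _ _)]
    simp

theorem totalEmb_isEquivalent (S : PlaneTree) :
    (fun n => (S.totalEmb n : ℝ)) ~[atTop] fun n : ℕ =>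
      S.weight / Real.Gamma ((S.order - 1) / 2) * 4 ^ n * (n : ℝ) ^ (((S.order : ℝ) - 3) / 2) := by
  have hα : (0 : ℝ) < (S.order - 1) / 2 := by
    have hsize := S.size_pos
    have hleaf := S.degreeCount_zero_pos
    have horder : 1 < S.order := by rw [order]; omega
    exact half_pos (sub_pos.2 (Nat.one_lt_cast.2 horder))
  have h := (hasSingularity_embGenFun_singleton S).isEquivalent four_ne_zero S.weight_pos.ne'
    (Real.Gamma_pos_of_pos hα).ne'
  rw [show ((S.order : ℝ) - 1) / 2 - 1 = (S.order - 3) / 2 by ring] at h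
  simpa only [coeff_embGenFun_singleton] using h

theorem totalGoodEmb_isEquivalent {S : PlaneTree} (hS : 2 ≤ S.size) :
    (fun n => (S.totalGoodEmb n : ℝ)) ~[atTop] fun n : ℕ =>
      2 * S.weight / Real.Gamma ((S.order - 2) / 2) * 4 ^ n *
        (n : ℝ) ^ (((S.order : ℝ) - 4) / 2) := by
  have hα : (0 : ℝ) < (S.order - 2) / 2 := by
    have hleaf := S.degreeCount_zero_pos
    have horder : 2 < S.order := by rw [order]; omega
    exact half_pos (sub_pos.2 (Nat.ofNat_lt_cast.2 horder))
  obtain ⟨L⟩ := S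
  have h := (hasSingularity_nonrootEmbGenFun L).isEquivalent four_ne_zero
    (mul_pos two_pos (node L).weight_pos).ne' (Real.Gamma_pos_of_pos hα).ne'
  rw [show ((node L).order - 2 : ℝ) / 2 - 1 = ((node L).order - 4) / 2 by ring] at h
  simpa only [coeff_nonrootEmbGenFun] using h

theorem Gamma_neg_one_half : Real.Gamma (-(1 / 2)) = -2 * √Real.pi := by
  have h := Real.Gamma_add_one (s := -(1 / 2)) (by norm_num)
  rw [show (-(1 / 2) : ℝ) + 1 = 1 / 2 by norm_num, Real.Gamma_one_half_eq] at h
  linarith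

theorem totalGoodEmb_node_nil_isEquivalent :
    (fun n => ((node []).totalGoodEmb n : ℝ)) ~[atTop] fun n : ℕ =>
      1 / (4 * √Real.pi) * 4 ^ n * (n : ℝ) ^ (-(3 / 2) : ℝ) := by
  have hsing : HasSingularity (nonrootEmbGenFun [] - C (1 / 2)) 4 (-(1 / 2)) (-(1 / 2)) := by
    refine ⟨Polynomial.C (-(1 / 2)), ?_, Polynomial.coeff_C_zero⟩
    simp only [nonrootEmbGenFun_nil, neg_neg, Polynomial.aeval_C, PowerSeries.algebraMap_apply,
      Algebra.algebraMap_self, RingHom.id_apply, map_neg]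
    ring
  have hpi : √Real.pi ≠ 0 := (Real.sqrt_pos.2 Real.pi_pos).ne'
  have hGamma : Real.Gamma (-(1 / 2)) ≠ 0 := by
    rw [Gamma_neg_one_half]
    exact mul_ne_zero (by norm_num) hpi
  have h := hsing.isEquivalent four_ne_zero (by norm_num) hGamma
  have hconst : -(1 / 2) / (-2 * √Real.pi) = 1 / (4 * √Real.pi) := by
    field_simp
    norm_num
  rw [Gamma_neg_one_half, hconst, show (-(1 / 2) - 1 : ℝ) = -(3 / 2) by norm_num] at h
  refine h.congr_left ?_
  filter_upwards [eventually_ne_atTop 0] with n hn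
  rw [map_sub, coeff_C, if_neg hn, sub_zero, coeff_nonrootEmbGenFun]

theorem eq_node_nil_of_size_eq_one : ∀ {S : PlaneTree}, S.size = 1 → S = node []
  | node [], _ => rfl
  | node (t :: L), h => by
    have := t.size_pos
    rw [size, List.map_cons, List.sum_cons] at h
    omega

end Asymptotics

end PlaneTree

theorem mainTheorem6 (S : PlaneTree) (m l : ℕ) (hm : m = S.size) (hl : l = S.degreeCount 0) :
    ((fun n : ℕ => (S.totalEmb n : ℝ)) ~[atTop]
      fun n : ℕ => (S.catalanConst : ℝ) * (1 / 2 : ℝ) ^ (m + l) / Real.Gamma (((m : ℝ) + l - 1) / 2)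
        * 4 ^ n * (n : ℝ) ^ (((m : ℝ) + l - 3) / 2)) ∧
    (2 ≤ m →
      (fun n : ℕ => (S.totalGoodEmb n : ℝ)) ~[atTop]
        fun n : ℕ => 2 * (S.catalanConst : ℝ) * (1 / 2 : ℝ) ^ (m + l)
          / Real.Gamma (((m : ℝ) + l - 2) / 2) * 4 ^ n * (n : ℝ) ^ (((m : ℝ) + l - 4) / 2)) ∧
    (m = 1 →
      (fun n : ℕ => (S.totalGoodEmb n : ℝ)) ~[atTop]
        fun n : ℕ => 1 / (4 * Real.sqrt Real.pi) * 4 ^ n * (n : ℝ) ^ (-(3 / 2) : ℝ)) := by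
  subst hm hl
  refine ⟨?_, fun hsize => ?_, fun hsize => ?_⟩
  · simpa only [PlaneTree.weight, PlaneTree.order, Nat.cast_add] using S.totalEmb_isEquivalent
  · simpa only [PlaneTree.weight, PlaneTree.order, Nat.cast_add, ← mul_assoc] using
      PlaneTree.totalGoodEmb_isEquivalent hsize
  · rw [PlaneTree.eq_node_nil_of_size_eq_one hsize]
    exact PlaneTree.totalGoodEmb_node_nil_isEquivalent
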